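/- **Setting.** There are $L$ items; item $i$ has a reward law $\nu_i$ with mean $\mu_i$. All reward laws belong to a one-parameter exponential family $\mathcal M$ supported on $[0,1]$: there are a nonzero $\sigma$-finite reference measure $\xi$ on $[0,1]$, a measurable statistic $S$ and an open set $\Theta\subseteq\mathbb R$ of natural parameters such that $\mathcal M=\{P_\theta:\theta\in\Theta\}$ with $\frac{dP_\theta}{d\xi}(x)=\exp(\theta S(x)-b(\theta))$ and $b(\theta)=\ln\int e^{\theta S}\,d\xi<\infty$, and every member of $\mathcal M$ is determined by its mean. The instance class is $\Lambda=\mathcal M^L$. Let $\mu_\star=\max_i\mu_i$ and $\Delta_i=\mu_\star-\mu_i$; item $i$ is suboptimal if $\Delta_i>0$. $D(P,Q)$ denotes the Kullback–Leibler divergence. For each horizon $T$, with free-exploration budget $T_{\mathrm{FE}}=T_{\mathrm{FE}}(T)\in\mathbb N$, a policy $\pi$ (which may depend on $T$ and may be randomized) selects the item $i_t$, $1\le t\le T$, on the basis of the items and rewards observed before round $t$; then, given the past and $i_t=i$, a reward with law $\nu_i$ is observed. Let $T_{i,n}=\sum_{t=1}^n\mathbf 1\{i_t=i\}$ and $$R_{T_{\mathrm{FE}}+1:T}(\pi;\nu)=(T-T_{\mathrm{FE}})\,\mu_\star-\mathbb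 E_\nu\Big[\sum_{t=T_{\mathrm{FE}}+1}^T\mu_{i_t}\Big].$$ The policy $\pi$ is consistent over $\Lambda$ if $R_{T_{\mathrm{FE}}+1:T}(\pi;\nu)=o(T^p)$ as $T\to\infty$ for every $\nu\in\Lambda$ and every $p>0$. For $\nu\in\Lambda$ with an optimal item $i^\star$ (that is, $\mu_{i^\star}=\mu_\star$) put $$\widetilde{\mathrm{Save}}(\pi;\nu,T_{\mathrm{FE}})=\sum_{i:\Delta_i>0}\Delta_i\min\Big\{\frac{\ln T}{D(\nu_i,\nu_{i^\star})},\ \mathbb E_\nu[T_{i,T_{\mathrm{FE}}}]\Big\}.$$ **Lemma.** Suppose that $T_{\mathrm{FE}}=o(T)$ and that $\pi$ is consistent over $\Lambda$. Let $\nu\in\Lambda$ and let $i^\star$ be an optimal item of $\nu$. Then every suboptimal item $i$ satisfies $$\liminf_{T\to\infty}\frac{\mathbb E_\nu[T_{i,T}]}{\ln T}\ \ge\ \frac1{D(\nu_i,\nu_{i^\star})},$$ and, furthermore, $$\liminf_{T\to\infty}\frac{R_{T_{\mathrm{FE}}+1:T}(\pi;\nu)}{\ln T}\ \ge\ \sum_{i:\Delta_i>0}\frac{\Delta_i}{D(\nu_i,\nu_{i^\star})}-\limsup_{T\to\infty}\frac{\widetilde{\mathrm{Save}}(\pi;\nu,T_{\mathrm{FE}})}{\ln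 T}.$$ -/

import Mathlib

open MeasureTheory ProbabilityTheory Filter Asymptotics InformationTheory

namespace FEBandit

noncomputable section

/-- The one-parameter exponential family with reference measure `ξ`, sufficient statistic `S` and
set of natural parameters `Θ`: all laws with `dν/dξ (x) = exp (θ * S x - b θ)`, where `θ ∈ Θ` and
`b θ = log ∫ exp (θ * S x) dξ`. The canonical family is the case `S x = x`. -/
def expFamily (ξ : Measure ℝ) (S : ℝ → ℝ) (Θ : Set ℝ) : Set (Measure ℝ) :=
  {ν | ∃ θ ∈ Θ, ν = ξ.tilted (fun x => θ * S x)}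

/-- The class of all bandit instances with `L` items whose reward laws lie in the family `M`. -/
def instanceClass (L : ℕ) (M : Set (Measure ℝ)) : Set (Fin L → Measure ℝ) :=
  {ν | ∀ i, ν i ∈ M}

/-- Mean of a reward law. -/
def mean (P : Measure ℝ) : ℝ := ∫ x, x ∂P

/-- Mean reward of an optimal item. -/
def bestMean {L : ℕ} (ν : Fin L → Measure ℝ) : ℝ := ⨆ i, mean (ν i)

/-- Optimality gap of item `i`. -/
def gap {L : ℕ} (ν : Fin L → Measure ℝ) (i : Fin L) : ℝ := bestMean ν - mean (ν i)

/-- Kullback-Leibler divergence as a real number. It is finite for any two members of an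
exponential family as above when `Θ` is open and `exp (θ * S x)` is integrable for `θ ∈ Θ`. -/
def kl (P Q : Measure ℝ) : ℝ := (klDiv P Q).toReal

/-- Observation histories after `n` rounds: `h t` is the item pulled in round `t + 1`, together
with the reward that was observed. -/
abbrev Hist (L n : ℕ) : Type := Fin n → Fin L × ℝ

/-- A (possibly randomized) policy: `rule n` is the conditional law of the item pulled in round
`n + 1` given the history of the first `n` rounds. A deterministic sampling rule, in which the item
is a measurable function of the history, is the case of a deterministic kernel. -/
structure Policy (L : ℕ) where
  rule : (n : ℕ) → Kernel (Hist L n) (Fin L)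
  markov : ∀ n, IsMarkovKernel (rule n)

/-- The reward law as a kernel: given the history and the chosen item `i`, the reward has
law `ν i`. -/
def rewardKernel {L : ℕ} (ν : Fin L → Measure ℝ) (n : ℕ) : Kernel (Hist L n × Fin L) ℝ :=
  (Kernel.ofFunOfCountable ν).comap Prod.snd measurable_snd

/-- Appending one round to a history. -/
def append {L n : ℕ} (p : Hist L n × (Fin L × ℝ)) : Hist L (n + 1) :=
  Fin.snoc (α := fun _ => Fin L × ℝ) p.1 p.2

theorem measurable_append {L n : ℕ} : Measurable (append (L := L) (n := n)) := by
  refine measurable_pi_lambda _ fun t => ?_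
  refine Fin.lastCases ?_ (fun s => ?_) t
  · simpa [append] using measurable_snd
  · simp only [append, Fin.snoc_castSucc]
    exact (measurable_pi_apply s).comp measurable_fst

/-- The law of the history of the first `n` rounds when policy `π` interacts with instance `ν`. -/
def histLaw {L : ℕ} (π : Policy L) (ν : Fin L → Measure ℝ) : (n : ℕ) → Measure (Hist L n)
  | 0 => Measure.dirac Fin.elim0
  | n + 1 => ((histLaw π ν n) ⊗ₘ (π.rule n ⊗ₖ rewardKernel ν n)).map append

theorem isProbabilityMeasure_histLaw {L : ℕ} (π : Policy L) (ν : Fin L → Measure ℝ)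
    (hν : ∀ i, IsProbabilityMeasure (ν i)) (n : ℕ) : IsProbabilityMeasure (histLaw π ν n) := by
  induction n with
  | zero => unfold histLaw; infer_instance
  | succ n ih =>
    have := π.markov n
    have : IsMarkovKernel (rewardKernel ν n) := by
      have : IsMarkovKernel (Kernel.ofFunOfCountable ν) := ⟨hν⟩
      unfold rewardKernel; infer_instance
    unfold histLaw
    exact Measure.isProbabilityMeasure_map measurable_append.aemeasurable

/-- Number of pulls of item `i` in the first `n` rounds of a history with `T` rounds. -/
def pulls {L T : ℕ} (i : Fin L) (n : ℕ) (h : Hist L T) : ℕ :=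
  (Finset.univ.filter fun t : Fin T => (t : ℕ) < n ∧ (h t).1 = i).card

/-- Expected number of pulls of item `i` in the first `n` rounds, with horizon `T`. -/
def expPulls {L : ℕ} (π : Policy L) (ν : Fin L → Measure ℝ) (T n : ℕ) (i : Fin L) : ℝ :=
  ∫ h, (pulls i n h : ℝ) ∂(histLaw π ν T)

/-- Pseudo-regret with horizon `T` accumulated after round `F`, that is in the rounds
`F + 1, …, T`. -/
def regretAfter {L : ℕ} (π : Policy L) (ν : Fin L → Measure ℝ) (F T : ℕ) : ℝ :=
  ((T : ℝ) - (F : ℝ)) * bestMean ν -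
    ∫ h, (∑ t ∈ Finset.univ.filter (fun t : Fin T => F ≤ (t : ℕ)), mean (ν (h t).1)) ∂(histLaw π ν T)

/-- An algorithm assigns a policy to every horizon `T` (with free-exploration budget `F T`). It is
consistent over `Λ` if on every instance of `Λ` its regret after the free-exploration phase is
`o(T ^ p)` for every `p > 0`. -/
def Consistent {L : ℕ} (Λ : Set (Fin L → Measure ℝ)) (F : ℕ → ℕ) (π : ℕ → Policy L) : Prop :=
  ∀ ν ∈ Λ, ∀ p : ℝ, 0 < p →
    (fun T : ℕ => regretAfter (π T) ν (F T) T) =o[atTop] (fun T : ℕ => (T : ℝ) ^ p)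

/-- Saved regret computed with the expected numbers of pulls in the free-exploration phase of
length `F`, with horizon `T` and reference item `star`. -/
def savedRegret {L : ℕ} (π : Policy L) (ν : Fin L → Measure ℝ) (star : Fin L) (F T : ℕ) : ℝ :=
  ∑ i with 0 < gap ν i,
    gap ν i * min (Real.log T / kl (ν i) (ν star)) (expPulls π ν T F i)

end

end FEBandit

/-! The proof is a change of measure. Given a suboptimal item `i`, replace only its law by a member
of the family whose mean exceeds the old optimum and whose divergence from `ν i` is barely above `kl
(ν i) (ν star)`. Continuity of the divergence and the mean in the natural parameter provides it
(`exists_mean_lt_and_kl_lt`).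

The log-likelihood ratio of the histories is a sum over the pulls of `i`, so its expectation is the
one-round divergence times the expected number of these pulls. The variational inequality `E f - KL
≤ log E' exp f` then bounds that number from below (`integral_sub_mul_expPulls_le`). It is applied
to a multiple of the fraction of rounds, after the free phase, spent on items other than `i`.
Consistency makes this fraction nearly 1 on the original instance and at most `T ^ (p - 1)` on the
modified one. With multiplier `(1 - p) * log T` the logarithm on the right stays below `log 2`, and
the logarithmic bound follows (`eventually_mul_log_le_of_forall_le`).

For the regret, only pulls after the free phase are charged. Adding the saved regret restores, for
each suboptimal item, almost `log T / kl`, whichever term attains the minimum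
(`sum_gap_mul_le_regretAfter_add_savedRegret`). -/

namespace FEBandit

/-! ### Exponential families: densities, divergence and mean as functions of the parameter -/

section ExpFamily

/-- The log-likelihood ratio of the members of an exponential family with natural parameters
`θ` and `θ'`. -/
noncomputable def logRatio (ξ : Measure ℝ) (S : ℝ → ℝ) (θ θ' : ℝ) (x : ℝ) : ℝ :=
  (θ - θ') * S x - (cgf S ξ θ - cgf S ξ θ')

variable {ξ : Measure ℝ} {S : ℝ → ℝ} {Θ : Set ℝ}

theorem measurable_logRatio (hS : Measurable S) (θ θ' : ℝ) : Measurable (logRatio ξ S θ θ') := by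
  unfold logRatio; fun_prop

theorem subset_interior_integrableExpSet (hΘ : IsOpen Θ)
    (hint : ∀ θ ∈ Θ, Integrable (fun x => Real.exp (θ * S x)) ξ) :
    Θ ⊆ interior (integrableExpSet S ξ) :=
  hΘ.subset_interior_iff.2 hint

theorem exp_cgf_of_integrable (hξ0 : ξ ≠ 0) {θ : ℝ}
    (h : Integrable (fun x => Real.exp (θ * S x)) ξ) :
    Real.exp (cgf S ξ θ) = ∫ x, Real.exp (θ * S x) ∂ξ :=
  have : NeZero ξ := ⟨hξ0⟩
  Real.exp_log (integral_exp_pos h)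

theorem tilted_eq_withDensity_logRatio (hξ0 : ξ ≠ 0) (hS : Measurable S) {θ θ' : ℝ}
    (h : Integrable (fun x => Real.exp (θ * S x)) ξ)
    (h' : Integrable (fun x => Real.exp (θ' * S x)) ξ) :
    ξ.tilted (fun x => θ * S x) = (ξ.tilted (fun x => θ' * S x)).withDensity
      (fun x => ENNReal.ofReal (Real.exp (logRatio ξ S θ θ' x))) := by
  unfold Measure.tilted
  rw [← withDensity_mul₀ (by fun_prop) ((measurable_logRatio hS θ θ').exp.ennreal_ofReal.aemeasurable)]
  congr 1
  ext x
  rw [Pi.mul_apply, ← ENNReal.ofReal_mul (by positivity), ← exp_cgf_of_integrable hξ0 h,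
    ← exp_cgf_of_integrable hξ0 h', ← Real.exp_sub, ← Real.exp_sub, ← Real.exp_add]
  congr 2
  unfold logRatio
  ring

theorem integrable_tilted_of_mem (hΘ : IsOpen Θ)
    (hint : ∀ θ ∈ Θ, Integrable (fun x => Real.exp (θ * S x)) ξ) {θ : ℝ} (hθ : θ ∈ Θ) :
    Integrable S (ξ.tilted (fun x => θ * S x)) := by
  rw [integrable_tilted_iff (hint θ hθ)]
  have := integrable_pow_mul_exp_of_mem_interior_integrableExpSet
    (subset_interior_integrableExpSet hΘ hint hθ) 1
  simpa [mul_comm] using this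

theorem integrable_logRatio (hξ0 : ξ ≠ 0) (hΘ : IsOpen Θ)
    (hint : ∀ θ ∈ Θ, Integrable (fun x => Real.exp (θ * S x)) ξ) {θ : ℝ} (hθ : θ ∈ Θ) (θ' : ℝ) :
    Integrable (logRatio ξ S θ θ') (ξ.tilted (fun x => θ * S x)) := by
  have : NeZero ξ := ⟨hξ0⟩
  have := isProbabilityMeasure_tilted (hint θ hθ)
  exact ((integrable_tilted_of_mem hΘ hint hθ).const_mul _).sub (integrable_const _)

theorem kl_tilted_eq_integral (hξ0 : ξ ≠ 0) (hS : Measurable S) {θ θ' : ℝ}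
    (h : Integrable (fun x => Real.exp (θ * S x)) ξ)
    (h' : Integrable (fun x => Real.exp (θ' * S x)) ξ) :
    kl (ξ.tilted (fun x => θ * S x)) (ξ.tilted (fun x => θ' * S x)) =
      ∫ x, logRatio ξ S θ θ' x ∂(ξ.tilted (fun x => θ * S x)) := by
  have : NeZero ξ := ⟨hξ0⟩
  have i1 := isProbabilityMeasure_tilted h
  have i2 := isProbabilityMeasure_tilted h'
  have hac : ξ.tilted (fun x => θ * S x) ≪ ξ.tilted (fun x => θ' * S x) :=
    (tilted_absolutelyContinuous _ _).trans (absolutelyContinuous_tilted h')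
  rw [kl, toReal_klDiv_of_measure_eq hac (by simp)]
  refine integral_congr_ae ?_
  have key := Measure.rnDeriv_withDensity (ξ.tilted (fun x => θ' * S x))
    (measurable_logRatio (ξ := ξ) hS θ θ').exp.ennreal_ofReal
  rw [← tilted_eq_withDensity_logRatio hξ0 hS h h'] at key
  filter_upwards [hac key] with x hx
  rw [llr, hx, ENNReal.toReal_ofReal (Real.exp_nonneg _), Real.log_exp]

/-- As a function of the second parameter the divergence is an affine function plus `cgf S ξ`, which
is analytic inside its domain. -/
theorem continuousOn_kl_tilted (hξ0 : ξ ≠ 0) (hS : Measurable S) (hΘ : IsOpen Θ)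
    (hint : ∀ θ ∈ Θ, Integrable (fun x => Real.exp (θ * S x)) ξ) {θ : ℝ} (hθ : θ ∈ Θ) :
    ContinuousOn (fun θ' => kl (ξ.tilted (fun x => θ * S x)) (ξ.tilted (fun x => θ' * S x))) Θ := by
  have : NeZero ξ := ⟨hξ0⟩
  have i1 := isProbabilityMeasure_tilted (hint θ hθ)
  have hc : ContinuousOn (cgf S ξ) Θ :=
    analyticOnNhd_cgf.continuousOn.mono (subset_interior_integrableExpSet hΘ hint)
  have : ContinuousOn (fun θ' => (θ - θ') * (∫ x, S x ∂(ξ.tilted (fun x => θ * S x))) -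
      (cgf S ξ θ - cgf S ξ θ')) Θ := by fun_prop
  refine this.congr fun θ' hθ' => ?_
  simp only
  rw [kl_tilted_eq_integral hξ0 hS (hint θ hθ) (hint θ' hθ')]
  unfold logRatio
  rw [integral_sub ((integrable_tilted_of_mem hΘ hint hθ).const_mul _) (integrable_const _),
    integral_const_mul]
  simp

/-- The mean is a quotient of two moment generating functions of `S`, one under `x dξ` and one under
`ξ`. Support in `[0,1]` makes the first measure positive and dominated by the second. -/
theorem continuousOn_mean_tilted (hξ0 : ξ ≠ 0) (hξ : ξ (Set.Icc (0 : ℝ) 1)ᶜ = 0) (hΘ : IsOpen Θ)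
    (hint : ∀ θ ∈ Θ, Integrable (fun x => Real.exp (θ * S x)) ξ) :
    ContinuousOn (fun θ => mean (ξ.tilted (fun x => θ * S x))) Θ := by
  have hae : ∀ᵐ x ∂ξ, x ∈ Set.Icc (0 : ℝ) 1 := mem_ae_iff.2 hξ
  set η := ξ.withDensity (fun x => ENNReal.ofReal x) with hη
  have hηi : ∀ θ ∈ Θ, Integrable (fun x => Real.exp (θ * S x)) η := by
    intro θ hθ
    rw [hη, integrable_withDensity_iff (by fun_prop) (by simp)]
    refine (hint θ hθ).mono ((hint θ hθ).aestronglyMeasurable.mul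
      ENNReal.measurable_ofReal.ennreal_toReal.aestronglyMeasurable) ?_
    filter_upwards [hae] with x hx
    rw [norm_mul, ENNReal.toReal_ofReal hx.1, Real.norm_of_nonneg hx.1]
    exact mul_le_of_le_one_right (norm_nonneg _) hx.2
  have h1 : ContinuousOn (mgf S η) Θ :=
    continuousOn_mgf.mono (subset_interior_integrableExpSet hΘ hηi)
  have h2 : ContinuousOn (mgf S ξ) Θ :=
    continuousOn_mgf.mono (subset_interior_integrableExpSet hΘ hint)
  have : NeZero ξ := ⟨hξ0⟩
  refine (h1.div h2 fun θ hθ => (integral_exp_pos (hint θ hθ)).ne').congr fun θ hθ => ?_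
  simp only [mean, Pi.div_apply]
  rw [integral_tilted, mgf, hη, integral_withDensity_eq_integral_toReal_smul (by fun_prop) (by simp),
    mgf, ← integral_div]
  refine integral_congr_ae ?_
  filter_upwards [hae] with x hx
  rw [ENNReal.toReal_ofReal hx.1, smul_eq_mul, smul_eq_mul]
  ring

/-- Two distinct natural parameters define the same law only if all natural parameters do. -/
theorem tilted_eq_of_tilted_eq_of_ne (hξ0 : ξ ≠ 0) (hS : Measurable S) {θ θ' : ℝ} (hne : θ ≠ θ')
    (h : Integrable (fun x => Real.exp (θ * S x)) ξ)
    (h' : Integrable (fun x => Real.exp (θ' * S x)) ξ)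
    (heq : ξ.tilted (fun x => θ * S x) = ξ.tilted (fun x => θ' * S x)) (u v : ℝ) :
    ξ.tilted (fun x => u * S x) = ξ.tilted (fun x => v * S x) := by
  have : NeZero ξ := ⟨hξ0⟩
  have i2 := isProbabilityMeasure_tilted h'
  have hd := tilted_eq_withDensity_logRatio hξ0 hS h h'
  rw [heq] at hd
  nth_rewrite 1 [← withDensity_one (μ := ξ.tilted (fun x => θ' * S x))] at hd
  rw [withDensity_eq_iff (by fun_prop)
    (measurable_logRatio hS θ θ').exp.ennreal_ofReal.aemeasurable (by simp)] at hd
  -- A likelihood ratio equal to 1 forces `S` to be almost everywhere constant; every tilt then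
  -- merely normalizes `ξ`.
  obtain ⟨c, hc⟩ : ∃ c : ℝ, ∀ᵐ x ∂ξ, S x = c := by
    refine ⟨(cgf S ξ θ - cgf S ξ θ') / (θ - θ'), ?_⟩
    filter_upwards [absolutelyContinuous_tilted h' hd] with x hx
    have hx' : Real.exp (logRatio ξ S θ θ' x) = 1 := by
      rw [← ENNReal.ofReal_eq_one]; exact hx.symm
    rw [Real.exp_eq_one_iff, logRatio] at hx'
    rw [eq_div_iff (sub_ne_zero.2 hne)]
    linarith
  have hconst : ∀ u : ℝ, ξ.tilted (fun x => u * S x) = (ξ Set.univ)⁻¹ • ξ := by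
    intro u
    rw [← tilted_const' ξ (u * c)]
    refine tilted_congr ?_
    filter_upwards [hc] with x hx
    rw [hx]
  rw [hconst, hconst]

/-- In a nontrivial exponential family parametrized by its means there are members with a larger
mean than a given one and with almost the same divergence from another given member. -/
theorem exists_mean_lt_and_kl_lt (hξ0 : ξ ≠ 0) (hξ : ξ (Set.Icc (0 : ℝ) 1)ᶜ = 0)
    (hS : Measurable S) (hΘ : IsOpen Θ)
    (hint : ∀ θ ∈ Θ, Integrable (fun x => Real.exp (θ * S x)) ξ)
    (hmean : Set.InjOn mean (expFamily ξ S Θ)) {θ₁ θ₀ : ℝ} (h₁ : θ₁ ∈ Θ) (h₀ : θ₀ ∈ Θ)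
    (hne : mean (ξ.tilted (fun x => θ₁ * S x)) ≠ mean (ξ.tilted (fun x => θ₀ * S x))) {D : ℝ}
    (hD : kl (ξ.tilted (fun x => θ₁ * S x)) (ξ.tilted (fun x => θ₀ * S x)) < D) :
    ∃ θ ∈ Θ, mean (ξ.tilted (fun x => θ₀ * S x)) < mean (ξ.tilted (fun x => θ * S x)) ∧
      kl (ξ.tilted (fun x => θ₁ * S x)) (ξ.tilted (fun x => θ * S x)) < D := by
  set m : ℝ → ℝ := fun θ => mean (ξ.tilted (fun x => θ * S x)) with hm
  have hmΘ : ContinuousOn m Θ := continuousOn_mean_tilted hξ0 hξ hΘ hint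
  -- `hmean` identifies laws, not parameters. A repeated parameter would collapse the family to one
  -- law, against `hne`.
  have hinj : Set.InjOn m Θ := by
    intro θ hθ θ' hθ' he
    by_contra hθθ'
    have := hmean ⟨θ, hθ, rfl⟩ ⟨θ', hθ', rfl⟩ he
    exact hne (congrArg mean
      (tilted_eq_of_tilted_eq_of_ne hξ0 hS hθθ' (hint _ hθ) (hint _ hθ') this _ _))
  have hev : ∀ᶠ θ in nhds θ₀, θ ∈ Θ ∧
      kl (ξ.tilted (fun x => θ₁ * S x)) (ξ.tilted (fun x => θ * S x)) < D :=
    Filter.Eventually.and (hΘ.mem_nhds h₀)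
      (((continuousOn_kl_tilted hξ0 hS hΘ hint h₁).continuousAt (hΘ.mem_nhds h₀)).eventually_lt_const
        hD)
  obtain ⟨ε, hε, hball⟩ := Metric.eventually_nhds_iff_ball.1 hev
  have hsub : ∀ θ ∈ Set.Icc (θ₀ - ε / 2) (θ₀ + ε / 2), θ ∈ Metric.ball θ₀ ε := by
    intro θ hθ
    rw [Real.ball_eq_Ioo]
    exact ⟨by linarith [hθ.1], by linarith [hθ.2]⟩
  have hsubΘ : Set.Icc (θ₀ - ε / 2) (θ₀ + ε / 2) ⊆ Θ := fun θ hθ => (hball θ (hsub θ hθ)).1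
  have hl : θ₀ - ε / 2 ∈ Set.Icc (θ₀ - ε / 2) (θ₀ + ε / 2) := ⟨le_rfl, by linarith⟩
  have hr : θ₀ + ε / 2 ∈ Set.Icc (θ₀ - ε / 2) (θ₀ + ε / 2) := ⟨by linarith, le_rfl⟩
  have hc : θ₀ ∈ Set.Icc (θ₀ - ε / 2) (θ₀ + ε / 2) := ⟨by linarith, by linarith⟩
  -- The mean may increase or decrease in the parameter, since `S` is arbitrary; one endpoint of the
  -- interval works in each case.
  rcases ContinuousOn.strictMonoOn_of_injOn_Icc' (by linarith) (hmΘ.mono hsubΘ)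
    (hinj.mono hsubΘ) with hmono | hanti
  · exact ⟨_, hsubΘ hr, hmono hc hr (by linarith), (hball _ (hsub _ hr)).2⟩
  · exact ⟨_, hsubΘ hl, hanti hl hc (by linarith), (hball _ (hsub _ hl)).2⟩

end ExpFamily

/-! ### Laws of histories: change of measure, centred sums, variational inequality -/

section History

variable {L : ℕ}

theorem isMarkovKernel_rewardKernel {ν : Fin L → Measure ℝ} (hν : ∀ i, IsProbabilityMeasure (ν i))
    (n : ℕ) : IsMarkovKernel (rewardKernel ν n) := by
  have : IsMarkovKernel (Kernel.ofFunOfCountable ν) := ⟨hν⟩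
  unfold rewardKernel; infer_instance

theorem lintegral_histLaw_succ (π : Policy L) {ν : Fin L → Measure ℝ}
    (hν : ∀ i, IsProbabilityMeasure (ν i)) (n : ℕ) {G : Hist L (n + 1) → ENNReal}
    (hG : Measurable G) :
    ∫⁻ h, G h ∂(histLaw π ν (n + 1)) =
      ∫⁻ h, ∫⁻ a, ∫⁻ x, G (append (h, (a, x))) ∂(ν a) ∂(π.rule n h) ∂(histLaw π ν n) := by
  have := π.markov n
  have := isMarkovKernel_rewardKernel hν n
  have := isProbabilityMeasure_histLaw π ν hν n
  rw [histLaw, lintegral_map hG measurable_append,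
    Measure.lintegral_compProd (f := fun p => G (append p)) (hG.comp measurable_append)]
  refine lintegral_congr fun h => ?_
  rw [Kernel.lintegral_compProd (f := fun p => G (append (h, p))) _ _ _ ((hG.comp measurable_append).comp measurable_prodMk_left)]
  rfl

/-- The sum over the rounds of a history of a function of the item and the reward. -/
def roundSum {n : ℕ} (φ : Fin L × ℝ → ℝ) (h : Hist L n) : ℝ := ∑ t, φ (h t)

theorem measurable_roundSum {n : ℕ} {φ : Fin L × ℝ → ℝ} (hφ : Measurable φ) :
    Measurable (roundSum (n := n) φ) := by
  unfold roundSum; fun_prop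

theorem roundSum_append {n : ℕ} (φ : Fin L × ℝ → ℝ) (p : Hist L n × (Fin L × ℝ)) :
    roundSum φ (append p) = roundSum φ p.1 + φ p.2 := by
  simp [roundSum, append, Fin.sum_univ_castSucc]

/-- Change of measure: the density of the history between two instances is the product of the
densities of the observed rewards. -/
theorem lintegral_histLaw_eq_lintegral_mul (π : Policy L) {ν ν' : Fin L → Measure ℝ}
    (hν : ∀ i, IsProbabilityMeasure (ν i)) (hν' : ∀ i, IsProbabilityMeasure (ν' i))
    {φ : Fin L × ℝ → ℝ} (hφ : Measurable φ)
    (hd : ∀ i, ν i = (ν' i).withDensity fun x => ENNReal.ofReal (Real.exp (φ (i, x)))) (n : ℕ)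
    {G : Hist L n → ENNReal} (hG : Measurable G) :
    ∫⁻ h, G h ∂(histLaw π ν n) =
      ∫⁻ h, G h * ENNReal.ofReal (Real.exp (roundSum φ h)) ∂(histLaw π ν' n) := by
  induction n with
  | zero =>
    simp only [histLaw]
    have hm : Measurable fun h => G h * ENNReal.ofReal (Real.exp (roundSum φ h)) :=
      hG.mul (measurable_roundSum hφ).exp.ennreal_ofReal
    rw [lintegral_dirac' _ hG, lintegral_dirac' _ hm]
    simp [roundSum]
  | succ n ih =>
    have := π.markov n
    have i1 := isMarkovKernel_rewardKernel hν n
    have hGa : Measurable fun p : (Hist L n × Fin L) × ℝ => G (append (p.1.1, (p.1.2, p.2))) :=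
      hG.comp (measurable_append.comp (by fun_prop))
    have hin : Measurable fun p : Hist L n × Fin L =>
        ∫⁻ x, G (append (p.1, (p.2, x))) ∂(ν p.2) :=
      hGa.lintegral_kernel_prod_right' (κ := rewardKernel ν n)
    have hH : Measurable fun h : Hist L n =>
        ∫⁻ a, ∫⁻ x, G (append (h, (a, x))) ∂(ν a) ∂(π.rule n h) :=
      hin.lintegral_kernel_prod_right'
    have hm : Measurable fun h => G h * ENNReal.ofReal (Real.exp (roundSum φ h)) :=
      hG.mul (measurable_roundSum hφ).exp.ennreal_ofReal
    rw [lintegral_histLaw_succ π hν n hG, ih hH, lintegral_histLaw_succ π hν' n hm]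
    refine lintegral_congr fun h => ?_
    rw [← lintegral_mul_const' _ _ ENNReal.ofReal_ne_top]
    refine lintegral_congr fun a => ?_
    have hGx : Measurable fun x : ℝ => G (append (h, (a, x))) :=
      hGa.comp (f := fun x : ℝ => ((h, a), x)) measurable_prodMk_left
    have hφx : Measurable fun x : ℝ => ENNReal.ofReal (Real.exp (φ (a, x))) := by fun_prop
    -- The policy kernel is common to both instances, so the new round contributes only the density
    -- of its reward.
    rw [hd a, lintegral_withDensity_eq_lintegral_mul _ hφx hGx,
      ← lintegral_mul_const' _ _ ENNReal.ofReal_ne_top]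
    refine lintegral_congr fun x => ?_
    rw [Pi.mul_apply, roundSum_append, Real.exp_add, ENNReal.ofReal_mul (Real.exp_nonneg _)]
    ring

/-- The round sums form a martingale: each increment has conditional mean zero whatever item is
chosen. -/
theorem integrable_and_integral_roundSum_eq_zero (π : Policy L) {ν : Fin L → Measure ℝ}
    (hν : ∀ i, IsProbabilityMeasure (ν i)) {φ : Fin L × ℝ → ℝ} (hφ : Measurable φ)
    (hi : ∀ i, Integrable (fun x => φ (i, x)) (ν i)) (h0 : ∀ i, ∫ x, φ (i, x) ∂(ν i) = 0)
    (n : ℕ) :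
    Integrable (roundSum φ) (histLaw π ν n) ∧ ∫ h, roundSum φ h ∂(histLaw π ν n) = 0 := by
  induction n with
  | zero => simp [histLaw, roundSum]
  | succ n ih =>
    have := π.markov n
    have := isMarkovKernel_rewardKernel hν n
    have := isProbabilityMeasure_histLaw π ν hν n
    have hker : ∀ h, Integrable φ ((π.rule n ⊗ₖ rewardKernel ν n) h) := by
      intro h
      rw [ProbabilityTheory.integrable_compProd_iff hφ.aestronglyMeasurable]
      exact ⟨Eventually.of_forall fun a => hi a, .of_finite⟩
    have hfst : Integrable (fun p : Hist L n × (Fin L × ℝ) => roundSum φ p.1)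
        (histLaw π ν n ⊗ₘ (π.rule n ⊗ₖ rewardKernel ν n)) := by
      have h1 := ih.1
      rw [← Measure.fst_compProd (histLaw π ν n) (π.rule n ⊗ₖ rewardKernel ν n)] at h1
      exact h1.comp_measurable measurable_fst
    have hnorm : ∀ h, ∫ y, ‖φ y‖ ∂((π.rule n ⊗ₖ rewardKernel ν n) h) ≤
        ∑ i, ∫ x, ‖φ (i, x)‖ ∂(ν i) := by
      intro h
      rw [ProbabilityTheory.integral_compProd (hker h).norm]
      calc _ ≤ ∫ a, (∑ i, ∫ x, ‖φ (i, x)‖ ∂(ν i)) ∂(π.rule n h) := by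
            refine integral_mono .of_finite (integrable_const _) fun a => ?_
            exact Finset.single_le_sum (f := fun i => ∫ x, ‖φ (i, x)‖ ∂(ν i))
              (fun i _ => integral_nonneg fun x => norm_nonneg _) (Finset.mem_univ a)
        _ = _ := by simp
    have hsnd : Integrable (fun p : Hist L n × (Fin L × ℝ) => φ p.2)
        (histLaw π ν n ⊗ₘ (π.rule n ⊗ₖ rewardKernel ν n)) := by
      rw [Measure.integrable_compProd_iff (f := fun p => φ p.2) (hφ.comp measurable_snd).aestronglyMeasurable]
      refine ⟨Eventually.of_forall hker, ?_⟩
      refine Integrable.of_bound (C := ∑ i, ∫ x, ‖φ (i, x)‖ ∂(ν i)) ?_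
        (Eventually.of_forall fun h => ?_)
      · exact (StronglyMeasurable.integral_kernel_prod_right'
          (hφ.comp measurable_snd).norm.stronglyMeasurable).aestronglyMeasurable
      · rw [Real.norm_of_nonneg (integral_nonneg fun x => norm_nonneg _)]
        exact hnorm h
    have hsnd0 : ∫ p, φ p.2 ∂(histLaw π ν n ⊗ₘ (π.rule n ⊗ₖ rewardKernel ν n)) = 0 := by
      rw [Measure.integral_compProd hsnd]
      refine integral_eq_zero_of_ae (Eventually.of_forall fun h => ?_)
      simp only
      rw [ProbabilityTheory.integral_compProd (hker h)]
      exact integral_eq_zero_of_ae (Eventually.of_forall fun a => h0 a)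
    have hfst0 : ∫ p, roundSum φ p.1 ∂(histLaw π ν n ⊗ₘ (π.rule n ⊗ₖ rewardKernel ν n)) = 0 := by
      rw [← ih.2, Measure.integral_compProd hfst]
      simp
    have hm := (measurable_roundSum (n := n + 1) hφ).aestronglyMeasurable
      (μ := histLaw π ν (n + 1))
    rw [histLaw] at hm ⊢
    rw [integrable_map_measure hm measurable_append.aemeasurable,
      integral_map measurable_append.aemeasurable hm]
    simp only [Function.comp_def, roundSum_append]
    exact ⟨hfst.add hsnd, by rw [integral_add hfst hsnd, hfst0, hsnd0, add_zero]⟩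

/-- The variational inequality between the laws of the history under two instances. -/
theorem integral_sub_le_log_integral_exp (π : Policy L) {ν ν' : Fin L → Measure ℝ}
    (hν : ∀ i, IsProbabilityMeasure (ν i)) (hν' : ∀ i, IsProbabilityMeasure (ν' i))
    {φ : Fin L × ℝ → ℝ} (hφ : Measurable φ)
    (hd : ∀ i, ν i = (ν' i).withDensity fun x => ENNReal.ofReal (Real.exp (φ (i, x)))) (n : ℕ)
    (hi : Integrable (roundSum φ) (histLaw π ν n))
    {f : Hist L n → ℝ} (hf : Measurable f) (hfi : Integrable f (histLaw π ν n))
    (hfe : Integrable (fun h => Real.exp (f h)) (histLaw π ν' n)) :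
    ∫ h, f h ∂(histLaw π ν n) - ∫ h, roundSum φ h ∂(histLaw π ν n) ≤
      Real.log (∫ h, Real.exp (f h) ∂(histLaw π ν' n)) := by
  have := isProbabilityMeasure_histLaw π ν hν n
  have := isProbabilityMeasure_histLaw π ν' hν' n
  have hum : Measurable fun h : Hist L n => Real.exp (f h - roundSum φ h) :=
    (hf.sub (measurable_roundSum hφ)).exp
  have hl : ∫⁻ h, ENNReal.ofReal (Real.exp (f h - roundSum φ h)) ∂(histLaw π ν n) =
      ∫⁻ h, ENNReal.ofReal (Real.exp (f h)) ∂(histLaw π ν' n) := by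
    -- The subtracted `roundSum φ` cancels the density of the history.
    rw [lintegral_histLaw_eq_lintegral_mul π hν hν' hφ hd n hum.ennreal_ofReal]
    refine lintegral_congr fun h => ?_
    rw [← ENNReal.ofReal_mul (Real.exp_nonneg _), ← Real.exp_add, sub_add_cancel]
  have hue : Integrable (fun h => Real.exp (f h - roundSum φ h)) (histLaw π ν n) := by
    refine ⟨hum.aestronglyMeasurable, ?_⟩
    rw [hasFiniteIntegral_iff_ofReal (Eventually.of_forall fun h => Real.exp_nonneg _), hl,
      ← hasFiniteIntegral_iff_ofReal (Eventually.of_forall fun h => Real.exp_nonneg _)]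
    exact hfe.2
  have heq : ∫ h, Real.exp (f h - roundSum φ h) ∂(histLaw π ν n) =
      ∫ h, Real.exp (f h) ∂(histLaw π ν' n) := by
    rw [integral_eq_lintegral_of_nonneg_ae (Eventually.of_forall fun h => Real.exp_nonneg _)
      hum.aestronglyMeasurable, hl, ← integral_eq_lintegral_of_nonneg_ae
      (Eventually.of_forall fun h => Real.exp_nonneg _) hfe.1]
  rw [← heq, ← integral_sub hfi hi, Real.le_log_iff_exp_le (integral_exp_pos hue)]
  -- Jensen's inequality for `exp`.
  exact convexOn_exp.map_integral_le Real.continuous_exp.continuousOn isClosed_univ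
    (Eventually.of_forall fun _ => Set.mem_univ _) (hfi.sub hi) hue

end History

/-! ### Regret in terms of pull counts -/

section Regret

variable {L : ℕ}

theorem integrable_sum_item (π : Policy L) {ν : Fin L → Measure ℝ}
    (hν : ∀ i, IsProbabilityMeasure (ν i)) {T : ℕ} (s : Finset (Fin T)) (c : Fin L → ℝ) :
    Integrable (fun h : Hist L T => ∑ t ∈ s, c (h t).1) (histLaw π ν T) := by
  have := isProbabilityMeasure_histLaw π ν hν T
  refine integrable_finsetSum _ fun t _ => ?_
  have hc : Measurable c := .of_discrete
  refine Integrable.of_bound (C := ∑ i, ‖c i‖)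
    (hc.comp (measurable_fst.comp (measurable_pi_apply t))).aestronglyMeasurable
    (Eventually.of_forall fun h => ?_)
  exact Finset.single_le_sum (f := fun i => ‖c i‖) (fun i _ => norm_nonneg _) (Finset.mem_univ _)

theorem cast_pulls {T : ℕ} (i : Fin L) (n : ℕ) (h : Hist L T) :
    (pulls i n h : ℝ) =
      ∑ t ∈ Finset.univ.filter (fun t : Fin T => (t : ℕ) < n), if (h t).1 = i then 1 else 0 := by
  rw [pulls, ← Finset.filter_filter, Finset.card_filter]
  push_cast
  rfl

theorem integrable_pulls (π : Policy L) {ν : Fin L → Measure ℝ}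
    (hν : ∀ i, IsProbabilityMeasure (ν i)) (T n : ℕ) (i : Fin L) :
    Integrable (fun h : Hist L T => (pulls i n h : ℝ)) (histLaw π ν T) := by
  simp_rw [cast_pulls]
  exact integrable_sum_item π hν _ fun j => if j = i then 1 else 0

theorem expPulls_nonneg (π : Policy L) (ν : Fin L → Measure ℝ) (T n : ℕ) (i : Fin L) :
    0 ≤ expPulls π ν T n i :=
  integral_nonneg fun _ => Nat.cast_nonneg _

theorem expPulls_mono (π : Policy L) {ν : Fin L → Measure ℝ}
    (hν : ∀ i, IsProbabilityMeasure (ν i)) (T : ℕ) (i : Fin L) {m n : ℕ} (hmn : m ≤ n) :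
    expPulls π ν T m i ≤ expPulls π ν T n i := by
  refine integral_mono (integrable_pulls π hν T m i) (integrable_pulls π hν T n i) fun h => ?_
  refine Nat.cast_le.2 (Finset.card_le_card fun t ht => ?_)
  simp only [Finset.mem_filter] at ht ⊢
  exact ⟨ht.1, ht.2.1.trans_le hmn, ht.2.2⟩

theorem bestMean_eq {ν : Fin L → Measure ℝ} {star : Fin L}
    (hstar : ∀ i, mean (ν i) ≤ mean (ν star)) : bestMean ν = mean (ν star) :=
  have : Nonempty (Fin L) := ⟨star⟩
  le_antisymm (ciSup_le hstar) (le_ciSup (f := fun i => mean (ν i)) (Set.finite_range _).bddAbove star)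

theorem gap_nonneg (ν : Fin L → Measure ℝ) (i : Fin L) : 0 ≤ gap ν i :=
  sub_nonneg.2 (le_ciSup (f := fun i => mean (ν i)) (Set.finite_range _).bddAbove i)

theorem card_filter_le_fin {F T : ℕ} :
    (Finset.univ.filter fun t : Fin T => F ≤ (t : ℕ)).card = T - F := by
  rw [Finset.card_filter, Fin.sum_univ_eq_sum_range (fun t => if F ≤ t then 1 else 0),
    ← Finset.card_filter, ← Nat.card_Ico]
  congr 1
  ext t
  simp [and_comm]

theorem regretAfter_eq_integral_gap (π : Policy L) {ν : Fin L → Measure ℝ}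
    (hν : ∀ i, IsProbabilityMeasure (ν i)) {F T : ℕ} (hFT : F ≤ T) :
    regretAfter π ν F T =
      ∫ h, ∑ t ∈ Finset.univ.filter (fun t : Fin T => F ≤ (t : ℕ)), gap ν (h t).1
        ∂(histLaw π ν T) := by
  have := isProbabilityMeasure_histLaw π ν hν T
  have hc : ((T : ℝ) - F) * bestMean ν = ∫ _ : Hist L T, ((T : ℝ) - F) * bestMean ν
      ∂(histLaw π ν T) := by simp
  rw [regretAfter, hc,
    ← integral_sub (integrable_const _) (integrable_sum_item π hν _ fun j => mean (ν j))]
  refine integral_congr_ae (Eventually.of_forall fun h => ?_)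
  simp only [gap, Finset.sum_sub_distrib, Finset.sum_const, card_filter_le_fin, nsmul_eq_mul,
    Nat.cast_sub hFT]

theorem regretAfter_eq_sum_gap_mul (π : Policy L) {ν : Fin L → Measure ℝ}
    (hν : ∀ i, IsProbabilityMeasure (ν i)) {F T : ℕ} (hFT : F ≤ T) :
    regretAfter π ν F T = ∑ i, gap ν i * (expPulls π ν T T i - expPulls π ν T F i) := by
  have hi : ∀ i, Integrable (fun h : Hist L T => gap ν i * ((pulls i T h : ℝ) - pulls i F h))
      (histLaw π ν T) := fun i =>
    ((integrable_pulls π hν T T i).sub (integrable_pulls π hν T F i)).const_mul _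
  have hE : ∀ i, gap ν i * (expPulls π ν T T i - expPulls π ν T F i) =
      ∫ h, gap ν i * ((pulls i T h : ℝ) - pulls i F h) ∂(histLaw π ν T) := by
    intro i
    rw [integral_const_mul, integral_sub (integrable_pulls π hν T T i)
      (integrable_pulls π hν T F i)]
    rfl
  simp_rw [hE]
  rw [regretAfter_eq_integral_gap π hν hFT, ← integral_finsetSum _ fun i _ => hi i]
  refine integral_congr_ae (Eventually.of_forall fun h => ?_)
  have hdiff : ∀ i, (pulls i T h : ℝ) - pulls i F h =
      ∑ t ∈ Finset.univ.filter (fun t : Fin T => F ≤ (t : ℕ)), if (h t).1 = i then 1 else 0 := by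
    intro i
    rw [cast_pulls, cast_pulls, sub_eq_iff_eq_add, Finset.filter_true_of_mem fun t _ => t.2, add_comm,
      ← Finset.sum_filter_add_sum_filter_not _ (fun t : Fin T => (t : ℕ) < F)]
    simp only [not_lt]
  simp only [hdiff, Finset.mul_sum]
  rw [Finset.sum_comm]
  simp

/-- The number of rounds after round `F` in which an item other than `i` is pulled. -/
def otherPulls {T : ℕ} (i : Fin L) (F : ℕ) (h : Hist L T) : ℝ :=
  ∑ t ∈ Finset.univ.filter (fun t : Fin T => F ≤ (t : ℕ)), if (h t).1 = i then 0 else 1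

theorem measurable_otherPulls {T : ℕ} (i : Fin L) (F : ℕ) :
    Measurable (otherPulls (T := T) i F) := by
  have hc : Measurable fun j : Fin L => if j = i then (0 : ℝ) else 1 := .of_discrete
  exact Finset.measurable_sum _ fun t _ => hc.comp (by fun_prop)

theorem otherPulls_nonneg {T : ℕ} (i : Fin L) (F : ℕ) (h : Hist L T) : 0 ≤ otherPulls i F h :=
  Finset.sum_nonneg fun t _ => by split_ifs <;> norm_num

theorem otherPulls_le {T : ℕ} (i : Fin L) (F : ℕ) (h : Hist L T) : otherPulls i F h ≤ T := by
  calc otherPulls i F h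
      ≤ ∑ t ∈ Finset.univ.filter (fun t : Fin T => F ≤ (t : ℕ)), (1 : ℝ) :=
        Finset.sum_le_sum fun t _ => by split_ifs <;> norm_num
    _ ≤ T := by
        rw [Finset.sum_const, card_filter_le_fin, nsmul_eq_mul, mul_one]
        exact_mod_cast Nat.sub_le T F

theorem integrable_otherPulls (π : Policy L) {ν : Fin L → Measure ℝ}
    (hν : ∀ i, IsProbabilityMeasure (ν i)) (T F : ℕ) (i : Fin L) :
    Integrable (otherPulls (T := T) i F) (histLaw π ν T) :=
  integrable_sum_item π hν _ fun j => if j = i then 0 else 1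

theorem gap_mul_sub_otherPulls_le_regretAfter (π : Policy L) {ν : Fin L → Measure ℝ}
    (hν : ∀ i, IsProbabilityMeasure (ν i)) {F T : ℕ} (hFT : F ≤ T) (i : Fin L) :
    gap ν i * (T - F - ∫ h, otherPulls i F h ∂(histLaw π ν T)) ≤ regretAfter π ν F T := by
  have := isProbabilityMeasure_histLaw π ν hν T
  have hc : (T : ℝ) - F = ∫ _ : Hist L T, ((T : ℝ) - F) ∂(histLaw π ν T) := by simp
  have hi := integrable_otherPulls π hν T F i
  rw [hc, ← integral_sub (integrable_const _) hi, ← integral_const_mul,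
    regretAfter_eq_integral_gap π hν hFT]
  refine integral_mono (((integrable_const _).sub hi).const_mul _)
    (integrable_sum_item π hν _ (gap ν)) fun h => ?_
  have : (T : ℝ) - F = ∑ t ∈ Finset.univ.filter (fun t : Fin T => F ≤ (t : ℕ)), (1 : ℝ) := by
    rw [Finset.sum_const, card_filter_le_fin, nsmul_eq_mul, mul_one, Nat.cast_sub hFT]
  simp only [this, otherPulls]
  rw [← Finset.sum_sub_distrib, Finset.mul_sum]
  refine Finset.sum_le_sum fun t _ => ?_
  split_ifs with hti
  · simp [hti]
  · simpa using gap_nonneg ν _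

theorem mul_otherPulls_le_regretAfter (π : Policy L) {ν : Fin L → Measure ℝ}
    (hν : ∀ i, IsProbabilityMeasure (ν i)) {F T : ℕ} (hFT : F ≤ T) (i : Fin L) {δ : ℝ}
    (hδ : ∀ j, j ≠ i → δ ≤ gap ν j) :
    δ * ∫ h, otherPulls i F h ∂(histLaw π ν T) ≤ regretAfter π ν F T := by
  rw [← integral_const_mul, regretAfter_eq_integral_gap π hν hFT]
  refine integral_mono ((integrable_otherPulls π hν T F i).const_mul _)
    (integrable_sum_item π hν _ (gap ν)) fun h => ?_
  simp only [otherPulls]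
  rw [Finset.mul_sum]
  refine Finset.sum_le_sum fun t _ => ?_
  split_ifs with hti
  · simpa using gap_nonneg ν _
  · simpa using hδ _ hti

end Regret

/-! ### Information lower bound on the number of pulls -/

section LowerBound

variable {L : ℕ}

/-- A Wald identity evaluates the divergence of the histories: subtracting the mean `D` from the
log-ratio at each pull of `i` leaves a centred sum, so the full sum has expectation `D` times the
expected pulls. -/
theorem integral_sub_mul_expPulls_le (π : Policy L) {ν ν' : Fin L → Measure ℝ}
    (hν : ∀ i, IsProbabilityMeasure (ν i)) (hν' : ∀ i, IsProbabilityMeasure (ν' i))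
    {i : Fin L} (hne : ∀ j, j ≠ i → ν j = ν' j) {g : ℝ → ℝ} (hg : Measurable g)
    (hd : ν i = (ν' i).withDensity fun x => ENNReal.ofReal (Real.exp (g x)))
    (hgi : Integrable g (ν i)) (T : ℕ) {f : Hist L T → ℝ} (hf : Measurable f)
    (hfi : Integrable f (histLaw π ν T))
    (hfe : Integrable (fun h => Real.exp (f h)) (histLaw π ν' T)) :
    ∫ h, f h ∂(histLaw π ν T) - (∫ x, g x ∂(ν i)) * expPulls π ν T T i ≤
      Real.log (∫ h, Real.exp (f h) ∂(histLaw π ν' T)) := by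
  set D := ∫ x, g x ∂(ν i) with hD
  have hind : MeasurableSet {p : Fin L × ℝ | p.1 = i} := measurable_fst (measurableSet_singleton i)
  set φ : Fin L × ℝ → ℝ := fun p => if p.1 = i then g p.2 else 0 with hφ
  set ψ : Fin L × ℝ → ℝ := fun p => if p.1 = i then g p.2 - D else 0 with hψ
  have hφm : Measurable φ := Measurable.ite hind (by fun_prop) measurable_const
  have hψm : Measurable ψ := Measurable.ite hind (by fun_prop) measurable_const
  have hψ0 := integrable_and_integral_roundSum_eq_zero π hν hψm
    (fun j => by
      by_cases hj : j = i
      · have := hν i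
        subst hj
        have hsub : Integrable (fun x => g x - D) (ν j) := hgi.sub (integrable_const D)
        simpa [hψ] using hsub
      · simp [hψ, hj])
    (fun j => by
      by_cases hj : j = i
      · have := hν i
        subst hj
        simp [hψ, integral_sub hgi (integrable_const D), ← hD]
      · simp [hψ, hj]) T
  have hsum : ∀ h : Hist L T, roundSum φ h = roundSum ψ h + D * (pulls i T h : ℝ) := by
    intro h
    rw [cast_pulls, Finset.filter_true_of_mem fun t _ => t.2, Finset.mul_sum, roundSum, roundSum,
      ← Finset.sum_add_distrib]
    refine Finset.sum_congr rfl fun t _ => ?_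
    by_cases ht : (h t).1 = i <;> simp [hφ, hψ, ht]
  have hp := (integrable_pulls π hν T T i).const_mul D
  have hφi : Integrable (roundSum φ) (histLaw π ν T) :=
    (hψ0.1.add hp).congr (Eventually.of_forall fun h => (hsum h).symm)
  have hφ0 : ∫ h, roundSum φ h ∂(histLaw π ν T) = D * expPulls π ν T T i := by
    simp_rw [hsum]
    rw [integral_add hψ0.1 hp, hψ0.2, zero_add, integral_const_mul, expPulls]
  rw [← hφ0]
  refine integral_sub_le_log_integral_exp π hν hν' hφm (fun j => ?_) T hφi hf hfi hfe
  by_cases hj : j = i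
  · subst hj
    simpa [hφ] using hd
  · simpa [hφ, hj, ← Pi.one_def] using hne j hj

/-- The chord of the convex function `exp` between 0 and `l`, with the term `-u` dropped. -/
theorem exp_mul_le_one_add {u : ℝ} (h0 : 0 ≤ u) (h1 : u ≤ 1) (l : ℝ) :
    Real.exp (l * u) ≤ 1 + Real.exp l * u := by
  have := convexOn_exp.2 (Set.mem_univ 0) (Set.mem_univ l) (sub_nonneg.2 h1) h0 (by ring)
  simp only [smul_eq_mul, mul_zero, zero_add, Real.exp_zero, mul_one] at this
  rw [mul_comm l u]
  nlinarith

theorem mul_otherPulls_div_le (π : Policy L) {ν ν' : Fin L → Measure ℝ}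
    (hν : ∀ i, IsProbabilityMeasure (ν i)) (hν' : ∀ i, IsProbabilityMeasure (ν' i))
    {i : Fin L} (hne : ∀ j, j ≠ i → ν j = ν' j) {g : ℝ → ℝ} (hg : Measurable g)
    (hd : ν i = (ν' i).withDensity fun x => ENNReal.ofReal (Real.exp (g x)))
    (hgi : Integrable g (ν i)) {T : ℕ} (hT : 0 < T) (F : ℕ) (l : ℝ) :
    l * ((∫ h, otherPulls i F h ∂(histLaw π ν T)) / T) ≤
      (∫ x, g x ∂(ν i)) * expPulls π ν T T i +
        Real.log (1 + Real.exp l * ((∫ h, otherPulls i F h ∂(histLaw π ν' T)) / T)) := by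
  have := isProbabilityMeasure_histLaw π ν' hν' T
  have hT' : (0 : ℝ) < T := Nat.cast_pos.2 hT
  have hu0 : ∀ h : Hist L T, 0 ≤ otherPulls i F h / T :=
    fun h => div_nonneg (otherPulls_nonneg i F h) hT'.le
  have hu1 : ∀ h : Hist L T, otherPulls i F h / T ≤ 1 :=
    fun h => (div_le_one hT').2 (otherPulls_le i F h)
  have hbound := fun h : Hist L T => exp_mul_le_one_add (hu0 h) (hu1 h) l
  have hf : Measurable fun h : Hist L T => l * (otherPulls i F h / T) :=
    ((measurable_otherPulls i F).div_const _).const_mul _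
  have hbi : Integrable (fun h : Hist L T => 1 + Real.exp l * (otherPulls i F h / T))
      (histLaw π ν' T) :=
    (integrable_const _).add (((integrable_otherPulls π hν' T F i).div_const _).const_mul _)
  have hfe : Integrable (fun h : Hist L T => Real.exp (l * (otherPulls i F h / T)))
      (histLaw π ν' T) :=
    hbi.mono' hf.exp.aestronglyMeasurable (Eventually.of_forall fun h => by
      rw [Real.norm_of_nonneg (Real.exp_nonneg _)]; exact hbound h)
  have key := integral_sub_mul_expPulls_le π hν hν' hne hg hd hgi T hf
    (((integrable_otherPulls π hν T F i).div_const _).const_mul _) hfe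
  rw [integral_const_mul, integral_div] at key
  have hle : ∫ h, Real.exp (l * (otherPulls i F h / T)) ∂(histLaw π ν' T) ≤
      1 + Real.exp l * ((∫ h, otherPulls i F h ∂(histLaw π ν' T)) / T) := by
    refine (integral_mono hfe hbi hbound).trans_eq ?_
    rw [integral_add (integrable_const _)
      (((integrable_otherPulls π hν' T F i).div_const _).const_mul _), integral_const_mul,
      integral_div]
    simp
  have hlog := Real.log_le_log (integral_exp_pos hfe) hle
  linarith

/-- The asymptotic form of the lower bound, for real sequences. -/
theorem eventually_mul_log_le_of_forall_le {N V V' : ℕ → ℝ} {c D : ℝ} (hD : 0 < D)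
    (hc : c * D < 1) (hV'0 : ∀ T, 0 ≤ V' T)
    (hV : ∀ p : ℝ, 0 < p → ∀ᶠ T : ℕ in atTop, (1 - p) * T ≤ V T)
    (hV' : ∀ p : ℝ, 0 < p → ∀ᶠ T : ℕ in atTop, V' T ≤ (T : ℝ) ^ p)
    (hK : ∀ᶠ T : ℕ in atTop, ∀ l : ℝ,
      l * (V T / T) ≤ D * N T + Real.log (1 + Real.exp l * (V' T / T))) :
    ∀ᶠ T : ℕ in atTop, c * Real.log T ≤ N T := by
  -- Since `(1 - p)² ≥ 1 - 2p`, this `p` costs at most half of the slack `1 - c * D`; the other half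
  -- absorbs `log 2`.
  obtain ⟨p, hp0, hp1, hp2⟩ : ∃ p : ℝ, 0 < p ∧ p < 1 ∧ p ≤ (1 - c * D) / 4 :=
    ⟨min (1 / 2) ((1 - c * D) / 4), lt_min (by norm_num) (by linarith),
      (min_le_left _ _).trans_lt (by norm_num), min_le_right _ _⟩
  have hlog : Tendsto (fun T : ℕ => Real.log T) atTop atTop :=
    Real.tendsto_log_atTop.comp tendsto_natCast_atTop_atTop
  filter_upwards [hV p hp0, hV' p hp0, hK, eventually_gt_atTop 0,
    hlog.eventually_ge_atTop (Real.log 2 / ((1 - c * D) / 2)),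
    hlog.eventually_ge_atTop 0] with T h1 h2 h3 hT h4 h5
  have hT' : (0 : ℝ) < T := Nat.cast_pos.2 hT
  have h6 := h3 ((1 - p) * Real.log T)
  have h7 : 1 - p ≤ V T / T := (le_div_iff₀ hT').2 h1
  -- The exponential equals `T / T ^ p`, exactly what `V' T ≤ T ^ p` can offset.
  have h8 : Real.exp ((1 - p) * Real.log T) * (V' T / T) ≤ 1 := by
    rw [mul_comm (1 - p), ← Real.rpow_def_of_pos hT', Real.rpow_sub hT', Real.rpow_one,
      div_mul_div_comm, div_le_one (by positivity)]
    rw [mul_comm ((T : ℝ) ^ p)]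
    gcongr
  have h9 : Real.log (1 + Real.exp ((1 - p) * Real.log T) * (V' T / T)) ≤ Real.log 2 := by
    refine Real.log_le_log ?_ (by linarith)
    have := hV'0 T
    positivity
  have h10 : (1 - p) * Real.log T * (1 - p) ≤ (1 - p) * Real.log T * (V T / T) :=
    mul_le_mul_of_nonneg_left h7 (mul_nonneg (by linarith) h5)
  rw [div_le_iff₀ (by linarith)] at h4
  have h11 : (1 - 2 * p) * Real.log T ≤ (1 - p) * Real.log T * (1 - p) := by
    nlinarith [mul_nonneg (sq_nonneg p) h5]
  have h12 : 2 * p * Real.log T ≤ (1 - c * D) / 2 * Real.log T :=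
    mul_le_mul_of_nonneg_right (by linarith) h5
  have h13 : D * (c * Real.log T) ≤ D * N T := by linarith
  exact le_of_mul_le_mul_left h13 hD

end LowerBound

/-! ### Consistency and the asymptotic bounds -/

section Asymptotics

variable {L : ℕ} {ξ : Measure ℝ} {S : ℝ → ℝ} {Θ : Set ℝ} {F : ℕ → ℕ} {π : ℕ → Policy L}
  {ν : Fin L → Measure ℝ}

theorem isProbabilityMeasure_of_mem_instanceClass (hξ0 : ξ ≠ 0)
    (hint : ∀ θ ∈ Θ, Integrable (fun x => Real.exp (θ * S x)) ξ)
    (hν : ν ∈ instanceClass L (expFamily ξ S Θ)) (i : Fin L) : IsProbabilityMeasure (ν i) := by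
  have : NeZero ξ := ⟨hξ0⟩
  obtain ⟨θ, hθ, h⟩ := hν i
  rw [h]
  exact isProbabilityMeasure_tilted (hint θ hθ)

theorem eventually_natCast_le_mul (hF : (fun T : ℕ => (F T : ℝ)) =o[atTop] (fun T : ℕ => (T : ℝ)))
    {a : ℝ} (ha : 0 < a) : ∀ᶠ T : ℕ in atTop, (F T : ℝ) ≤ a * T := by
  filter_upwards [hF.def ha] with T h
  simpa using h

theorem eventually_budget_le (hF : (fun T : ℕ => (F T : ℝ)) =o[atTop] (fun T : ℕ => (T : ℝ))) :
    ∀ᶠ T : ℕ in atTop, F T ≤ T := by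
  filter_upwards [eventually_natCast_le_mul hF one_pos] with T h
  rw [one_mul] at h
  exact_mod_cast h

theorem Consistent.eventually_regretAfter_le {Λ : Set (Fin L → Measure ℝ)}
    (hπ : Consistent Λ F π) (hν : ν ∈ Λ) {p a : ℝ} (hp : 0 < p) (ha : 0 < a) :
    ∀ᶠ T : ℕ in atTop, regretAfter (π T) ν (F T) T ≤ a * (T : ℝ) ^ p := by
  filter_upwards [(hπ ν hν p hp).def ha] with T h
  rw [Real.norm_of_nonneg (by positivity : (0 : ℝ) ≤ (T : ℝ) ^ p)] at h
  exact (le_abs_self _).trans h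

/-- A consistent algorithm pulls a suboptimal item at least a logarithmic number of times. -/
theorem eventually_mul_log_le_expPulls (hξ0 : ξ ≠ 0) (hξ : ξ (Set.Icc (0 : ℝ) 1)ᶜ = 0)
    (hS : Measurable S) (hΘ : IsOpen Θ)
    (hint : ∀ θ ∈ Θ, Integrable (fun x => Real.exp (θ * S x)) ξ)
    (hmean : Set.InjOn mean (expFamily ξ S Θ))
    (hF : (fun T : ℕ => (F T : ℝ)) =o[atTop] (fun T : ℕ => (T : ℝ)))
    (hπ : Consistent (instanceClass L (expFamily ξ S Θ)) F π)
    (hν : ν ∈ instanceClass L (expFamily ξ S Θ)) {star : Fin L}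
    (hstar : ∀ i, mean (ν i) ≤ mean (ν star)) {i : Fin L} (hi : 0 < gap ν i) {c : ℝ}
    (hc : c < 1 / kl (ν i) (ν star)) :
    ∀ᶠ T : ℕ in atTop, c * Real.log T ≤ expPulls (π T) ν T T i := by
  -- For `c > 0` the hypothesis `hc` itself yields a positive divergence, because `1 / 0 = 0`.
  rcases le_or_gt c 0 with hc0 | hc0
  · filter_upwards with T
    exact (mul_nonpos_of_nonpos_of_nonneg hc0 (Real.log_natCast_nonneg T)).trans
      (expPulls_nonneg _ _ _ _ _)
  have hk : 0 < kl (ν i) (ν star) := one_div_pos.1 (hc0.trans hc)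
  obtain ⟨D, hkD, hDc⟩ := exists_between ((lt_one_div hc0 hk).1 hc)
  have hD0 : 0 < D := hk.trans hkD
  rw [lt_div_iff₀ hc0, mul_comm] at hDc
  have hlt : mean (ν i) < mean (ν star) := by
    rw [gap, bestMean_eq hstar] at hi
    linarith
  obtain ⟨θ₁, h₁, hν₁⟩ := hν i
  obtain ⟨θ₀, h₀, hν₀⟩ := hν star
  rw [hν₁, hν₀] at hlt hkD
  obtain ⟨θ, hθ, hθmean, hθkl⟩ := exists_mean_lt_and_kl_lt hξ0 hξ hS hΘ hint hmean h₁ h₀ hlt.ne hkD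
  set ν' : Fin L → Measure ℝ := Function.update ν i (ξ.tilted fun x => θ * S x) with hν'def
  have hν'i : ν' i = ξ.tilted fun x => θ * S x := Function.update_self _ _ _
  have hν'j : ∀ j, j ≠ i → ν j = ν' j := fun j hj => (Function.update_of_ne hj _ _).symm
  have hν' : ν' ∈ instanceClass L (expFamily ξ S Θ) := by
    intro j
    by_cases hj : j = i
    · exact ⟨θ, hθ, hj ▸ hν'i⟩
    · exact hν'j j hj ▸ hν j
  have hP := isProbabilityMeasure_of_mem_instanceClass hξ0 hint hν
  have hP' := isProbabilityMeasure_of_mem_instanceClass hξ0 hint hν'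
  -- On `ν'` every item other than `i` falls short of the best mean by at least this excess.
  set δ := mean (ν' i) - mean (ν star) with hδdef
  have hδ : 0 < δ := by rw [hδdef, hν'i, hν₀]; linarith
  have hgap' : ∀ j, j ≠ i → δ ≤ gap ν' j := by
    intro j hj
    have h1 := gap_nonneg ν' i
    have h2 := hstar j
    rw [hν'j j hj] at h2
    rw [gap] at h1 ⊢
    linarith
  refine eventually_mul_log_le_of_forall_le (D := D)
    (V := fun T => ∫ h, otherPulls i (F T) h ∂(histLaw (π T) ν T))
    (V' := fun T => ∫ h, otherPulls i (F T) h ∂(histLaw (π T) ν' T)) hD0 hDc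
    (fun T => integral_nonneg fun h => otherPulls_nonneg i _ h) ?_ ?_ ?_
  · intro p hp
    -- The free phase and the rounds spent on `i` after it each take at most `p / 2 * T`.
    filter_upwards [eventually_budget_le hF, eventually_natCast_le_mul hF (half_pos hp),
      hπ.eventually_regretAfter_le hν one_pos (mul_pos hi (half_pos hp))] with T hFT h1 h2
    rw [Real.rpow_one, mul_assoc] at h2
    have := le_of_mul_le_mul_left
      ((gap_mul_sub_otherPulls_le_regretAfter (π T) hP hFT i).trans h2) hi
    linarith
  · intro p hp
    filter_upwards [eventually_budget_le hF, hπ.eventually_regretAfter_le hν' hp hδ] with T hFT h1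
    exact le_of_mul_le_mul_left ((mul_otherPulls_le_regretAfter (π T) hP' hFT i hgap').trans h1) hδ
  · filter_upwards [eventually_gt_atTop 0] with T hT l
    have key := mul_otherPulls_div_le (π T) hP hP' hν'j
      (measurable_logRatio (ξ := ξ) hS θ₁ θ)
      (by rw [hν₁, hν'i]; exact tilted_eq_withDensity_logRatio hξ0 hS (hint _ h₁) (hint _ hθ))
      (by rw [hν₁]; exact integrable_logRatio hξ0 hΘ hint h₁ θ) hT (F T) l
    have hint' : ∫ x, logRatio ξ S θ₁ θ x ∂(ν i) ≤ D := by
      rw [hν₁, ← kl_tilted_eq_integral hξ0 hS (hint _ h₁) (hint _ hθ)]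
      exact hθkl.le
    have := mul_le_mul_of_nonneg_right hint' (expPulls_nonneg (π T) ν T T i)
    linarith

/-- If the minimum is `log T / kl`, it suffices alone, as later pulls are nonnegative; otherwise
free and later pulls add up to the total, and `hlow` applies. -/
theorem sum_gap_mul_le_regretAfter_add_savedRegret (π : Policy L)
    (hν : ∀ i, IsProbabilityMeasure (ν i)) (star : Fin L) {F T : ℕ} (hFT : F ≤ T) {ε : ℝ}
    (hε : 0 ≤ ε)
    (hlow : ∀ i, 0 < gap ν i →
      (1 / kl (ν i) (ν star) - ε) * Real.log T ≤ expPulls π ν T T i) :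
    ∑ i with 0 < gap ν i, gap ν i * ((1 / kl (ν i) (ν star) - ε) * Real.log T) ≤
      regretAfter π ν F T + savedRegret π ν star F T := by
  have hreg : ∑ i with 0 < gap ν i, gap ν i * (expPulls π ν T T i - expPulls π ν T F i) ≤
      regretAfter π ν F T := by
    rw [regretAfter_eq_sum_gap_mul π hν hFT]
    exact Finset.sum_le_sum_of_subset_of_nonneg (Finset.filter_subset _ _) fun i _ _ =>
      mul_nonneg (gap_nonneg ν i) (sub_nonneg.2 (expPulls_mono π hν T i hFT))
  refine le_trans ?_ (add_le_add_left hreg _)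
  rw [savedRegret, ← Finset.sum_add_distrib]
  refine Finset.sum_le_sum fun i hi => ?_
  rw [← mul_add]
  refine mul_le_mul_of_nonneg_left ?_ (gap_nonneg ν i)
  have hmono := expPulls_mono π hν T i hFT
  have hl := Real.log_natCast_nonneg T
  rcases min_choice (Real.log T / kl (ν i) (ν star)) (expPulls π ν T F i) with h | h <;> rw [h]
  · rw [sub_mul, one_div_mul_eq_div]
    nlinarith [mul_nonneg hε hl]
  · linarith [hlow i (Finset.mem_filter.1 hi).2]

end Asymptotics

end FEBandit

/-! ### Passage to lower and upper limits -/

theorem mainTheorem6 {L : ℕ} (ξ : MeasureTheory.Measure ℝ) [MeasureTheory.SigmaFinite ξ]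
    (hξ0 : ξ ≠ 0) (hξ : ξ (Set.Icc (0 : ℝ) 1)ᶜ = 0)
    (S : ℝ → ℝ) (hS : Measurable S) (Θ : Set ℝ) (hΘ : IsOpen Θ)
    (hint : ∀ θ ∈ Θ, MeasureTheory.Integrable (fun x => Real.exp (θ * S x)) ξ)
    (hmean : Set.InjOn FEBandit.mean (FEBandit.expFamily ξ S Θ))
    (F : ℕ → ℕ) (hF : (fun T : ℕ => (F T : ℝ)) =o[atTop] (fun T : ℕ => (T : ℝ)))
    (π : ℕ → FEBandit.Policy L)
    (hπ : FEBandit.Consistent (FEBandit.instanceClass L (FEBandit.expFamily ξ S Θ)) F π)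
    (ν : Fin L → MeasureTheory.Measure ℝ) (hν : ν ∈ FEBandit.instanceClass L (FEBandit.expFamily ξ S Θ))
    (star : Fin L) (hstar : ∀ i, FEBandit.mean (ν i) ≤ FEBandit.mean (ν star)) :
    (∀ i, 0 < FEBandit.gap ν i →
      ((1 / FEBandit.kl (ν i) (ν star) : ℝ) : EReal) ≤
        liminf (fun T : ℕ => ((FEBandit.expPulls (π T) ν T T i / Real.log T : ℝ) : EReal))
          atTop) ∧
    ((∑ i with 0 < FEBandit.gap ν i,
          FEBandit.gap ν i / FEBandit.kl (ν i) (ν star) : ℝ) : EReal) -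
        limsup (fun T : ℕ =>
          ((FEBandit.savedRegret (π T) ν star (F T) T / Real.log T : ℝ) : EReal)) atTop ≤
      liminf (fun T : ℕ =>
        ((FEBandit.regretAfter (π T) ν (F T) T / Real.log T : ℝ) : EReal)) atTop := by
  have hlow : ∀ i, 0 < FEBandit.gap ν i → ∀ c < 1 / FEBandit.kl (ν i) (ν star),
      ∀ᶠ T : ℕ in atTop, c * Real.log T ≤ FEBandit.expPulls (π T) ν T T i := fun i hi c hc =>
    FEBandit.eventually_mul_log_le_expPulls hξ0 hξ hS hΘ hint hmean hF hπ hν hstar hi hc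
  have hlog : ∀ᶠ T : ℕ in atTop, 0 < Real.log T := by
    filter_upwards [eventually_gt_atTop 1] with T hT
    exact Real.log_pos (by exact_mod_cast hT)
  have hP := FEBandit.isProbabilityMeasure_of_mem_instanceClass hξ0 hint hν
  refine ⟨fun i hi => ?_, ?_⟩
  · refine EReal.ge_of_forall_gt_iff_ge.1 fun c hc => ?_
    refine le_liminf_of_le (by isBoundedDefault) ?_
    filter_upwards [hlow i hi c (EReal.coe_lt_coe_iff.1 hc), hlog] with T h1 h2
    exact EReal.coe_le_coe_iff.2 ((le_div_iff₀ h2).2 h1)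
  · set A : ℝ := ∑ i with 0 < FEBandit.gap ν i, FEBandit.gap ν i / FEBandit.kl (ν i) (ν star)
      with hA
    set C : ℝ := ∑ i with 0 < FEBandit.gap ν i, FEBandit.gap ν i with hC
    have hC0 : 0 ≤ C := Finset.sum_nonneg fun i _ => FEBandit.gap_nonneg ν i
    refine EReal.ge_of_forall_gt_iff_ge.1 fun c hc => ?_
    -- Arguing by contradiction moves the upper limit across the subtraction without treating
    -- infinite values separately.
    have hsup : limsup (fun T : ℕ =>
        ((FEBandit.savedRegret (π T) ν star (F T) T / Real.log T : ℝ) : EReal)) atTop <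
        ((A - c : ℝ) : EReal) := by
      by_contra hcon
      refine absurd hc (not_lt.2 ((EReal.sub_le_sub le_rfl (not_lt.1 hcon)).trans ?_))
      rw [← EReal.coe_sub, EReal.coe_le_coe_iff]
      linarith
    obtain ⟨q, hq1, hq2⟩ := EReal.lt_iff_exists_real_btwn.1 hsup
    rw [EReal.coe_lt_coe_iff] at hq2
    -- The `+ 1` keeps the denominator positive when no item is suboptimal.
    set ε := (A - c - q) / (C + 1) with hε
    have hε0 : 0 < ε := div_pos (by linarith) (by linarith)
    have hεC : ε * C ≤ A - c - q := by
      have : ε * (C + 1) = A - c - q := div_mul_cancel₀ _ (by linarith)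
      linarith
    have hall : ∀ᶠ T : ℕ in atTop, ∀ i, 0 < FEBandit.gap ν i →
        (1 / FEBandit.kl (ν i) (ν star) - ε) * Real.log T ≤ FEBandit.expPulls (π T) ν T T i := by
      refine eventually_all.2 fun i => ?_
      by_cases hi : 0 < FEBandit.gap ν i
      · filter_upwards [hlow i hi _ (sub_lt_self _ hε0)] with T h _ using h
      · exact Eventually.of_forall fun T h => absurd h hi
    refine le_liminf_of_le (by isBoundedDefault) ?_
    filter_upwards [hall, hlog, eventually_lt_of_limsup_lt hq1, FEBandit.eventually_budget_le hF]
      with T h1 h2 h3 hFT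
    rw [EReal.coe_lt_coe_iff, div_lt_iff₀ h2] at h3
    have key := FEBandit.sum_gap_mul_le_regretAfter_add_savedRegret (π T) hP star hFT hε0.le h1
    have hsum : ∑ i with 0 < FEBandit.gap ν i, FEBandit.gap ν i *
        ((1 / FEBandit.kl (ν i) (ν star) - ε) * Real.log T) = (A - ε * C) * Real.log T := by
      rw [hA, hC, Finset.mul_sum, ← Finset.sum_sub_distrib, Finset.sum_mul]
      exact Finset.sum_congr rfl fun i _ => by ring
    rw [hsum] at key
    rw [EReal.coe_le_coe_iff, le_div_iff₀ h2]
    have := mul_le_mul_of_nonneg_right (by linarith : c + q ≤ A - ε * C) h2.le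
    linarith
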